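/- For a finite signed Borel measure $\mu$ on $\mathbb{R}$ let $-\Delta+\mu$ be the self-adjoint operator in the complex Hilbert space $L^2(\mathbb{R})$ associated (by Kato's first representation theorem) with the closed, lower semibounded symmetric form $$a_\mu(f,g)=\int_{\mathbb{R}} f'(x)\,\overline{g'(x)}\,dx+\int_{\mathbb{R}} f\,\overline{g}\,d\mu,\qquad D(a_\mu)=H^1(\mathbb{R}),$$ where elements of $H^1(\mathbb{R})$ are identified with their continuous representatives. Let $n\in\mathbb{N}$, let $x_1<x_2<\dots<x_n$ and $\alpha_1,\dots,\alpha_n$ be real numbers, and let $k\in\{1,\dots,n\}$ be such that $\alpha_k<0$. If $$\frac{\alpha_k}{2}e^{-\alpha_k x_k}+\sum_{j:\,x_j<x_k}\alpha_j e^{-\alpha_k x_j}+e^{-2\alpha_k x_k}\sum_{j:\,x_j>x_k}\alpha_j e^{\alpha_k x_j}<0,$$ then the operator $-\Delta+\sum_{j=1}^n\alpha_j\delta_{x_j}$ has at least one negative eigenvalue. -/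

import Mathlib

open MeasureTheory Set
open scoped ContDiff ENNReal InnerProductSpace ComplexConjugate

noncomputable section

namespace PointInteraction

/-- The complex Hilbert space `L²(ℝ)`. -/
abbrev L2 : Type := Lp ℂ 2 (volume : Measure ℝ)

/-- `g` is the weak (distributional) derivative of `f`. -/
def IsWeakDeriv (f g : L2) : Prop :=
  ∀ φ : ℝ → ℝ, ContDiff ℝ ∞ φ → HasCompactSupport φ →
    ∫ x, deriv φ x • f x = -∫ x, φ x • g x

theorem locallyIntegrable_L2 (f : L2) : LocallyIntegrable (f : ℝ → ℂ) volume :=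
  (Lp.memLp f).locallyIntegrable (by norm_num)

theorem integrable_test_smul {φ : ℝ → ℝ} (hφ : Continuous φ) (hc : HasCompactSupport φ)
    {h : ℝ → ℂ} (hh : LocallyIntegrable h volume) : Integrable (fun x => φ x • h x) volume :=
  hh.integrable_smul_left_of_hasCompactSupport hφ hc

theorem integrable_deriv_test_smul {φ : ℝ → ℝ} (hφ : ContDiff ℝ ∞ φ) (hc : HasCompactSupport φ)
    {h : ℝ → ℂ} (hh : LocallyIntegrable h volume) :
    Integrable (fun x => deriv φ x • h x) volume :=
  integrable_test_smul (hφ.continuous_deriv (by simp)) hc.deriv hh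

theorem IsWeakDeriv.add {f₁ f₂ g₁ g₂ : L2} (h₁ : IsWeakDeriv f₁ g₁) (h₂ : IsWeakDeriv f₂ g₂) :
    IsWeakDeriv (f₁ + f₂) (g₁ + g₂) := by
  intro φ hφ hc
  have e1 : ∫ x, deriv φ x • (f₁ + f₂ : L2) x = ∫ x, (deriv φ x • f₁ x + deriv φ x • f₂ x) := by
    refine integral_congr_ae ?_
    filter_upwards [Lp.coeFn_add f₁ f₂] with x hx
    rw [hx, Pi.add_apply, smul_add]
  have e2 : ∫ x, φ x • (g₁ + g₂ : L2) x = ∫ x, (φ x • g₁ x + φ x • g₂ x) := by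
    refine integral_congr_ae ?_
    filter_upwards [Lp.coeFn_add g₁ g₂] with x hx
    rw [hx, Pi.add_apply, smul_add]
  rw [e1, e2, integral_add, integral_add, h₁ φ hφ hc, h₂ φ hφ hc, neg_add]
  · exact integrable_test_smul hφ.continuous hc (locallyIntegrable_L2 _)
  · exact integrable_test_smul hφ.continuous hc (locallyIntegrable_L2 _)
  · exact integrable_deriv_test_smul hφ hc (locallyIntegrable_L2 _)
  · exact integrable_deriv_test_smul hφ hc (locallyIntegrable_L2 _)

theorem IsWeakDeriv.smul {f g : L2} (h : IsWeakDeriv f g) (c : ℂ) :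
    IsWeakDeriv (c • f) (c • g) := by
  intro φ hφ hc
  have e1 : ∫ x, deriv φ x • (c • f : L2) x = ∫ x, c • (deriv φ x • f x) := by
    refine integral_congr_ae ?_
    filter_upwards [Lp.coeFn_smul c f] with x hx
    rw [hx, Pi.smul_apply, smul_comm]
  have e2 : ∫ x, φ x • (c • g : L2) x = ∫ x, c • (φ x • g x) := by
    refine integral_congr_ae ?_
    filter_upwards [Lp.coeFn_smul c g] with x hx
    rw [hx, Pi.smul_apply, smul_comm]
  rw [e1, e2, integral_smul, integral_smul, h φ hφ hc, smul_neg]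

theorem isWeakDeriv_zero : IsWeakDeriv 0 0 := by
  intro φ _ _
  have e (ψ : ℝ → ℝ) : ∫ x, ψ x • (0 : L2) x = 0 := by
    rw [← integral_zero ℝ ℂ]
    refine integral_congr_ae ?_
    filter_upwards [Lp.coeFn_zero ℂ 2 (volume : Measure ℝ)] with x hx
    rw [hx, Pi.zero_apply, smul_zero]
  rw [e, e, neg_zero]

theorem IsWeakDeriv.unique {f g₁ g₂ : L2} (h₁ : IsWeakDeriv f g₁) (h₂ : IsWeakDeriv f g₂) :
    g₁ = g₂ := by
  refine Lp.ext (ae_eq_of_integral_contDiff_smul_eq (locallyIntegrable_L2 _)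
    (locallyIntegrable_L2 _) fun φ hφ hc => ?_)
  exact neg_injective ((h₁ φ hφ hc).symm.trans (h₂ φ hφ hc))

/-- The Sobolev space `H¹(ℝ)`: the `L²` functions with a weak derivative in `L²`. -/
def H1 : Submodule ℂ L2 where
  carrier := {f | ∃ g : L2, IsWeakDeriv f g}
  add_mem' := fun ⟨_, h₁⟩ ⟨_, h₂⟩ => ⟨_, h₁.add h₂⟩
  zero_mem' := ⟨0, isWeakDeriv_zero⟩
  smul_mem' := fun c _ ⟨_, h⟩ => ⟨_, h.smul c⟩

/-- The weak derivative `f'` of `f ∈ H¹(ℝ)`. -/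
def weakDeriv (f : H1) : L2 := f.2.choose

theorem weakDeriv_spec (f : H1) : IsWeakDeriv (f : L2) (weakDeriv f) := f.2.choose_spec

theorem weakDeriv_add (f g : H1) : weakDeriv (f + g) = weakDeriv f + weakDeriv g :=
  (weakDeriv_spec (f + g)).unique ((weakDeriv_spec f).add (weakDeriv_spec g))

theorem weakDeriv_smul (c : ℂ) (f : H1) : weakDeriv (c • f) = c • weakDeriv f :=
  (weakDeriv_spec (c • f)).unique ((weakDeriv_spec f).smul c)

theorem integral_deriv_smul_primitive {g : ℝ → ℂ} (hg : LocallyIntegrable g volume)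
    {φ : ℝ → ℝ} (hφ : ContDiff ℝ ∞ φ) (hc : HasCompactSupport φ) :
    ∫ x, deriv φ x • (∫ t in (0 : ℝ)..x, g t) = -∫ x, φ x • g x := by
  have hii : ∀ a b : ℝ, IntervalIntegrable g volume a b := fun a b =>
    (hg.integrableOn_isCompact isCompact_uIcc).intervalIntegrable
  have hdc : Continuous (deriv φ) := hφ.continuous_deriv (by simp)
  obtain ⟨r, hr⟩ : ∃ r : ℝ, tsupport φ ⊆ Icc (-r) r := by
    obtain ⟨r, hr⟩ := hc.isCompact.isBounded.subset_closedBall (0 : ℝ)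
    exact ⟨r, by simpa [Real.closedBall_eq_Icc] using hr⟩
  have hφ0 : ∀ x, x ∉ Icc (-r) r → φ x = 0 := fun x hx =>
    image_eq_zero_of_notMem_tsupport fun h => hx (hr h)
  have hd0 : ∀ x, x ∉ Icc (-r) r → deriv φ x = 0 := fun x hx =>
    image_eq_zero_of_notMem_tsupport fun h => hx (hr (tsupport_deriv_subset h))
  have hint0 : ∫ x, deriv φ x = 0 := by
    have := integral_of_hasDerivAt_of_tendsto (f := φ) (f' := deriv φ)
      (fun x => (hφ.differentiable (by simp) x).hasDerivAt)
      (hdc.integrable_of_hasCompactSupport hc.deriv)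
      (m := 0) (n := 0)
      ?_ ?_
    · simpa using this
    · exact (hc.is_zero_at_infty.mono_left _root_.atBot_le_cocompact)
    · exact (hc.is_zero_at_infty.mono_left _root_.atTop_le_cocompact)
  set G : ℝ → ℂ := (Ioc (-r - 1) r).indicator g with hG
  have hGi : Integrable G volume :=
    (integrable_indicator_iff measurableSet_Ioc).2
      ((hg.integrableOn_isCompact isCompact_Icc).mono_set Ioc_subset_Icc_self)
  have hprim : ∀ x, deriv φ x • (∫ t in (0 : ℝ)..x, g t)
      = deriv φ x • (∫ t in Iic x, G t) + deriv φ x • (∫ t in (0 : ℝ)..(-r - 1), g t) := by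
    intro x
    by_cases hx : x ∈ Icc (-r) r
    · have : ∫ t in Iic x, G t = ∫ t in (-r - 1)..x, g t := by
        rw [hG, setIntegral_indicator measurableSet_Ioc, intervalIntegral.integral_of_le
          (by linarith [hx.1])]
        congr 2
        ext t
        simp only [mem_inter_iff, mem_Iic, mem_Ioc]
        exact ⟨fun h => ⟨h.2.1, h.1⟩, fun h => ⟨h.2, h.1, h.2.trans hx.2⟩⟩
      rw [this, ← smul_add, add_comm, intervalIntegral.integral_add_adjacent_intervals
        (hii _ _) (hii _ _)]
    · simp [hd0 x hx]
  have hKint : Integrable (fun p : ℝ × ℝ => {p : ℝ × ℝ | p.2 ≤ p.1}.indicator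
      (fun p => deriv φ p.1 • G p.2) p) (volume.prod volume) := by
    refine Integrable.indicator ?_ (measurableSet_le measurable_snd measurable_fst)
    exact (hdc.integrable_of_hasCompactSupport hc.deriv).smul_prod hGi
  have hsw := integral_integral_swap (f := fun x t : ℝ => {p : ℝ × ℝ | p.2 ≤ p.1}.indicator
      (fun p => deriv φ p.1 • G p.2) (x, t)) hKint
  have hL : ∀ x, (∫ t, {p : ℝ × ℝ | p.2 ≤ p.1}.indicator
      (fun p => deriv φ p.1 • G p.2) (x, t)) = deriv φ x • ∫ t in Iic x, G t := by
    intro x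
    rw [← integral_smul, ← integral_indicator measurableSet_Iic]
    rfl
  have hR : ∀ t, (∫ x, {p : ℝ × ℝ | p.2 ≤ p.1}.indicator
      (fun p => deriv φ p.1 • G p.2) (x, t)) = -(φ t • g t) := by
    intro t
    have : (∫ x, {p : ℝ × ℝ | p.2 ≤ p.1}.indicator
      (fun p => deriv φ p.1 • G p.2) (x, t)) = ∫ x in Ici t, deriv φ x • G t := by
      rw [← integral_indicator measurableSet_Ici]
      rfl
    rw [this, integral_smul_const, integral_Ici_eq_integral_Ioi,
      HasCompactSupport.integral_Ioi_deriv_eq (hφ.of_le (by simp)) hc]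
    by_cases ht : t ∈ Icc (-r) r
    · rw [hG, indicator_of_mem (show t ∈ Ioc (-r - 1) r from ⟨by linarith [ht.1], ht.2⟩), neg_smul]
    · simp [hφ0 t ht]
  simp only [hL, hR] at hsw
  simp only [hprim]
  rw [integral_add, hsw, integral_neg, integral_smul_const, hint0, zero_smul, add_zero]
  · have := hKint.integral_prod_left
    simpa only [hL] using this
  · exact (hdc.integrable_of_hasCompactSupport hc.deriv).smul_const _

theorem ae_const_of_integral_deriv_smul_eq_zero {h : ℝ → ℂ} (hh : LocallyIntegrable h volume)
    (H : ∀ φ : ℝ → ℝ, ContDiff ℝ ∞ φ → HasCompactSupport φ → ∫ x, deriv φ x • h x = 0) :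
    ∃ c : ℂ, ∀ᵐ x, h x = c := by
  let b : ContDiffBump (0 : ℝ) := ⟨1, 2, one_pos, one_lt_two⟩
  set η : ℝ → ℝ := b.normed volume with hη
  have hη1 : ContDiff ℝ ∞ η := b.contDiff_normed
  have hη2 : HasCompactSupport η := b.hasCompactSupport_normed
  have hη3 : ∫ x, η x = 1 := b.integral_normed
  refine ⟨∫ x, η x • h x, ?_⟩
  refine ae_eq_of_integral_contDiff_smul_eq hh
    (f' := fun _ => ∫ x, η x • h x) continuous_const.locallyIntegrable fun ψ hψ hψc => ?_
  set θ : ℝ → ℝ := fun x => ψ x - (∫ y, ψ y) * η x with hθ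
  have hψi : Integrable ψ volume := hψ.continuous.integrable_of_hasCompactSupport hψc
  have hηi : Integrable η volume := hη1.continuous.integrable_of_hasCompactSupport hη2
  have hθ1 : ContDiff ℝ ∞ θ := hψ.sub (contDiff_const.mul hη1)
  have hθ2 : HasCompactSupport θ := hψc.sub hη2.mul_left
  have hθi : Integrable θ volume := hθ1.continuous.integrable_of_hasCompactSupport hθ2
  have hθ0 : ∫ x, θ x = 0 := by
    rw [hθ, integral_sub hψi (hηi.const_mul _), integral_const_mul, hη3, mul_one, sub_self]
  obtain ⟨r, hr⟩ : ∃ r : ℝ, tsupport θ ⊆ Icc (-r) r := by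
    obtain ⟨r, hr⟩ := hθ2.isCompact.isBounded.subset_closedBall (0 : ℝ)
    exact ⟨r, by simpa [Real.closedBall_eq_Icc] using hr⟩
  have hz : ∀ x, x ∉ Icc (-r) r → θ x = 0 := fun x hx =>
    image_eq_zero_of_notMem_tsupport fun h => hx (hr h)
  set Φ : ℝ → ℝ := fun x => ∫ t in (-r - 1)..x, θ t with hΦ
  have hΦd : ∀ x, HasDerivAt Φ (θ x) x := fun x =>
    intervalIntegral.integral_hasDerivAt_right hθi.intervalIntegrable
      hθ1.continuous.stronglyMeasurable.stronglyMeasurableAtFilter hθ1.continuous.continuousAt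
  have hΦd' : deriv Φ = θ := funext fun x => (hΦd x).deriv
  have hΦ1 : ContDiff ℝ ∞ Φ :=
    contDiff_infty_iff_deriv.2 ⟨fun x => (hΦd x).differentiableAt, by rw [hΦd']; exact hθ1⟩
  have hΦ2 : HasCompactSupport Φ := by
    refine HasCompactSupport.intro (K := Icc (-r) r) isCompact_Icc fun x hx => ?_
    rcases lt_or_ge x (-r) with hlt | hge
    · refine intervalIntegral.integral_zero_ae (Filter.Eventually.of_forall fun t htm => ?_)
      refine hz t fun h => ?_
      have h2 : t ≤ max (-r - 1) x := htm.2
      rcases le_max_iff.1 h2 with h3 | h3 <;> linarith [h.1]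
    · have hxr : r < x := by
        by_contra hcon
        exact hx ⟨hge, not_lt.1 hcon⟩
      rw [hΦ, ← hθ0]
      refine intervalIntegral.integral_eq_integral_of_support_subset fun t ht => ?_
      by_contra hcon
      refine ht (hz t fun h => hcon ⟨by linarith [h.1], h.2.trans hxr.le⟩)
  have key := H Φ hΦ1 hΦ2
  rw [hΦd'] at key
  have e : ∀ x, θ x • h x = ψ x • h x - (∫ y, ψ y) • (η x • h x) := fun x => by
    simp only [hθ, sub_smul, mul_smul]
  simp only [e] at key
  have hηh : Integrable (fun x => (∫ y, ψ y) • (η x • h x)) volume :=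
    (integrable_test_smul hη1.continuous hη2 hh).smul (∫ y, ψ y)
  rw [integral_sub (integrable_test_smul hψ.continuous hψc hh) hηh, integral_smul,
    sub_eq_zero] at key
  rw [key, integral_smul_const]

theorem exists_continuous_primitive (f : H1) :
    ∃ F : ℝ → ℂ, Continuous F ∧ F =ᵐ[volume] (f : L2) ∧
      ∀ a b, F b - F a = ∫ t in a..b, weakDeriv f t := by
  have hg : LocallyIntegrable (weakDeriv f : ℝ → ℂ) volume := locallyIntegrable_L2 _
  have hii : ∀ a b : ℝ, IntervalIntegrable (weakDeriv f : ℝ → ℂ) volume a b := fun a b =>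
    (hg.integrableOn_isCompact isCompact_uIcc).intervalIntegrable
  set G : ℝ → ℂ := fun x => ∫ t in (0 : ℝ)..x, weakDeriv f t with hG
  have hGc : Continuous G := intervalIntegral.continuous_primitive hii 0
  obtain ⟨c, hcst⟩ := ae_const_of_integral_deriv_smul_eq_zero
    (h := fun x => (f : L2) x - G x) ((locallyIntegrable_L2 _).sub hGc.locallyIntegrable) (by
      intro φ hφ hc
      simp only [smul_sub]
      rw [integral_sub (integrable_deriv_test_smul hφ hc (locallyIntegrable_L2 _))
        (integrable_deriv_test_smul hφ hc hGc.locallyIntegrable),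
        integral_deriv_smul_primitive hg hφ hc, weakDeriv_spec f φ hφ hc, sub_self])
  refine ⟨fun x => G x + c, hGc.add continuous_const, ?_, fun a b => ?_⟩
  · filter_upwards [hcst] with x hx
    rw [← hx, add_sub_cancel]
  · rw [add_sub_add_right_eq_sub, hG]
    exact intervalIntegral.integral_interval_sub_left (hii _ _) (hii _ _)

/-- The continuous representative of `f ∈ H¹(ℝ)`, through which `f` has values at points. -/
def contRep (f : H1) : ℝ → ℂ := (exists_continuous_primitive f).choose

theorem continuous_contRep (f : H1) : Continuous (contRep f) :=
  (exists_continuous_primitive f).choose_spec.1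

theorem contRep_ae_eq (f : H1) : contRep f =ᵐ[volume] (f : L2) :=
  (exists_continuous_primitive f).choose_spec.2.1

theorem contRep_sub (f : H1) (a b : ℝ) :
    contRep f b - contRep f a = ∫ t in a..b, weakDeriv f t :=
  (exists_continuous_primitive f).choose_spec.2.2 a b

theorem contRep_unique (f : H1) {F : ℝ → ℂ} (hF : Continuous F)
    (h : F =ᵐ[volume] (f : L2)) : contRep f = F :=
  Continuous.ae_eq_iff_eq volume (continuous_contRep f) hF |>.1 ((contRep_ae_eq f).trans h.symm)

theorem contRep_add (f g : H1) : contRep (f + g) = contRep f + contRep g := by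
  refine contRep_unique _ ((continuous_contRep f).add (continuous_contRep g)) ?_
  exact ((contRep_ae_eq f).add (contRep_ae_eq g)).trans (Lp.coeFn_add (f : L2) (g : L2)).symm

theorem contRep_smul (c : ℂ) (f : H1) : contRep (c • f) = c • contRep f := by
  refine contRep_unique _ ((continuous_contRep f).const_smul c) ?_
  exact ((contRep_ae_eq f).const_smul c).trans (Lp.coeFn_smul c (f : L2)).symm

theorem exists_bound_contRep (f : H1) : ∃ C : ℝ, ∀ x, ‖contRep f x‖ ≤ C := by
  have hf2 : Integrable (fun x => ‖contRep f x‖ ^ 2) volume := by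
    refine ((memLp_two_iff_integrable_sq_norm
      (continuous_contRep f).aestronglyMeasurable).1 ?_)
    exact (memLp_congr_ae (contRep_ae_eq f)).2 (Lp.memLp _)
  have hg2 : Integrable (fun x => ‖weakDeriv f x‖ ^ 2) volume :=
    (memLp_two_iff_integrable_sq_norm (Lp.memLp _).1).1 (Lp.memLp _)
  have hgl : LocallyIntegrable (weakDeriv f : ℝ → ℂ) volume := locallyIntegrable_L2 _
  refine ⟨(1 + ∫ x, ‖contRep f x‖ ^ 2) + (1 + ∫ x, ‖weakDeriv f x‖ ^ 2), fun x => ?_⟩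
  have aux : ∀ {h : ℝ → ℂ}, IntervalIntegrable (fun t => ‖h t‖) volume x (x + 1) →
      Integrable (fun t => ‖h t‖ ^ 2) volume →
      ∫ t in x..(x + 1), ‖h t‖ ≤ 1 + ∫ t, ‖h t‖ ^ 2 := by
    intro h h1 h2
    have hle : x ≤ x + 1 := by linarith
    calc ∫ t in x..(x + 1), ‖h t‖ ≤ ∫ t in x..(x + 1), (1 + ‖h t‖ ^ 2) := by
          refine intervalIntegral.integral_mono_on hle h1
            ((intervalIntegrable_const).add h2.intervalIntegrable) fun t _ => ?_
          nlinarith [sq_nonneg (‖h t‖ - 1), norm_nonneg (h t)]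
      _ = 1 + ∫ t in x..(x + 1), ‖h t‖ ^ 2 := by
          rw [intervalIntegral.integral_add intervalIntegrable_const h2.intervalIntegrable]
          simp
      _ ≤ 1 + ∫ t, ‖h t‖ ^ 2 := by
          gcongr
          rw [intervalIntegral.integral_of_le hle]
          exact setIntegral_le_integral h2 (Filter.Eventually.of_forall fun t => by positivity)
  have hgi : ∀ a b : ℝ, IntervalIntegrable (fun t => ‖weakDeriv f t‖) volume a b := fun a b =>
    (hgl.integrableOn_isCompact isCompact_uIcc).intervalIntegrable.norm
  have hfi : IntervalIntegrable (fun t => ‖contRep f t‖) volume x (x + 1) :=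
    (continuous_contRep f).norm.intervalIntegrable _ _
  have hpt : ∀ y ∈ Icc x (x + 1), ‖contRep f x‖ ≤
      ‖contRep f y‖ + ∫ t in x..(x + 1), ‖weakDeriv f t‖ := by
    intro y hy
    have h1 : ‖contRep f y - contRep f x‖ ≤ ∫ t in x..(x + 1), ‖weakDeriv f t‖ := by
      rw [contRep_sub]
      refine (intervalIntegral.norm_integral_le_integral_norm hy.1).trans ?_
      refine intervalIntegral.integral_mono_interval le_rfl hy.1 hy.2
        (Filter.Eventually.of_forall fun t => norm_nonneg _) (hgi _ _)
    have h2 := norm_sub_norm_le (contRep f x) (contRep f y)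
    rw [norm_sub_rev] at h2
    linarith
  have hint : ‖contRep f x‖ ≤ (∫ t in x..(x + 1), ‖contRep f t‖)
      + ∫ t in x..(x + 1), ‖weakDeriv f t‖ := by
    have := intervalIntegral.integral_mono_on (show x ≤ x + 1 by linarith)
      (intervalIntegrable_const) (hfi.add intervalIntegrable_const) hpt
    rw [intervalIntegral.integral_add hfi intervalIntegrable_const] at this
    simpa using this
  exact hint.trans (add_le_add (aux hfi hf2) (aux (hgi _ _) hg2))

/-- The form `a_μ(f, g) = ∫ f' (conj g') dx + ∫ f (conj g) dμ` with domain `H¹(ℝ)`, for a finite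
signed Borel measure `μ` on `ℝ`. -/
def form (μ : SignedMeasure ℝ) (f g : H1) : ℂ :=
  (∫ x, weakDeriv f x * conj (weakDeriv g x)) +
    ∫ᵛ x, contRep f x * conj (contRep g x) ∂<•μ

theorem integrable_contRep_mul (μ : SignedMeasure ℝ) (f g : H1) :
    μ.Integrable (fun x => contRep f x * conj (contRep g x)) := by
  have hfin : IsFiniteMeasure μ.variation := by
    rw [← SignedMeasure.totalVariation_eq_variation, SignedMeasure.totalVariation]
    infer_instance
  obtain ⟨C, hC⟩ := exists_bound_contRep f
  obtain ⟨D, hD⟩ := exists_bound_contRep g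
  refine Integrable.of_bound (C := C * D) ?_ (Filter.Eventually.of_forall fun x => ?_)
  · exact ((continuous_contRep f).mul
      (Complex.continuous_conj.comp (continuous_contRep g))).aestronglyMeasurable
  · rw [norm_mul, RCLike.norm_conj]
    exact mul_le_mul (hC x) (hD x) (norm_nonneg _) ((norm_nonneg _).trans (hC x))

theorem integral_mul_conj (f g : L2) : ∫ x, f x * conj (g x) = ⟪g, f⟫_ℂ := by
  rw [L2.inner_def]
  rfl

theorem form_add_left (μ : SignedMeasure ℝ) (f₁ f₂ g : H1) :
    form μ (f₁ + f₂) g = form μ f₁ g + form μ f₂ g := by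
  simp only [form, integral_mul_conj, weakDeriv_add, inner_add_right, contRep_add,
    Pi.add_apply, add_mul]
  rw [VectorMeasure.integral_fun_add (integrable_contRep_mul μ f₁ g)
    (integrable_contRep_mul μ f₂ g)]
  ring

theorem integral_const_mul_signed (μ : SignedMeasure ℝ) (c : ℂ) (h : ℝ → ℂ) :
    ∫ᵛ x, c * h x ∂<•μ = c * ∫ᵛ x, h x ∂<•μ := by
  simp only [VectorMeasure.integral_eq_setToFun, ← smul_eq_mul]
  refine setToFun_smul (𝕜 := ℂ) _ (fun c s x => ?_) c h
  simp only [transpose_eq_cbmApplyMeasure, cbmApplyMeasure_apply,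
    ContinuousLinearMap.flip_apply, ContinuousLinearMap.lsmul_apply]
  exact smul_comm _ _ _

theorem form_smul_left (μ : SignedMeasure ℝ) (c : ℂ) (f g : H1) :
    form μ (c • f) g = c * form μ f g := by
  simp only [form, integral_mul_conj, weakDeriv_smul, inner_smul_right, contRep_smul,
    Pi.smul_apply, smul_eq_mul, mul_assoc, mul_add]
  congr 1
  exact integral_const_mul_signed μ c _

/-- The graph of `-Δ + μ`: all pairs `(f, u)` with `f ∈ H¹(ℝ)`, `u ∈ L²(ℝ)` and
`⟨u, g⟩ = a_μ(f, g)` for every `g ∈ H¹(ℝ)`. Mathlib's inner product is antilinear in its first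
argument, so `⟨u, g⟩ = ∫ u (conj g)` is written `⟪g, u⟫_ℂ`. -/
def schrodingerGraph (μ : SignedMeasure ℝ) : Submodule ℂ (L2 × L2) where
  carrier := {p | ∃ f : H1, (f : L2) = p.1 ∧ ∀ g : H1, ⟪(g : L2), p.2⟫_ℂ = form μ f g}
  add_mem' := by
    rintro p q ⟨f₁, h₁, k₁⟩ ⟨f₂, h₂, k₂⟩
    refine ⟨f₁ + f₂, by simp [h₁, h₂], fun g => ?_⟩
    rw [Prod.snd_add, inner_add_right, k₁, k₂, form_add_left]
  zero_mem' := by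
    refine ⟨0, rfl, fun g => ?_⟩
    have := form_smul_left μ 0 0 g
    rw [zero_smul, zero_mul] at this
    simp [this]
  smul_mem' := by
    rintro c p ⟨f, h, k⟩
    refine ⟨c • f, by simp [h], fun g => ?_⟩
    rw [Prod.smul_snd, inner_smul_right, k, form_smul_left]

theorem schwartz_mem_H1 (s : SchwartzMap ℝ ℂ) : s.toLp 2 volume ∈ H1 := by
  refine ⟨(SchwartzMap.derivCLM ℂ ℂ s).toLp 2 volume, fun φ hφ hc => ?_⟩
  have e1 : ∫ x, deriv φ x • (s.toLp 2 volume) x = ∫ x, deriv φ x • s x := by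
    refine integral_congr_ae ?_
    filter_upwards [s.coeFn_toLp 2 volume] with x hx
    rw [hx]
  have e2 : ∫ x, φ x • ((SchwartzMap.derivCLM ℂ ℂ s).toLp 2 volume) x
      = ∫ x, φ x • deriv s x := by
    refine integral_congr_ae ?_
    filter_upwards [(SchwartzMap.derivCLM ℂ ℂ s).coeFn_toLp 2 volume] with x hx
    rw [hx, SchwartzMap.derivCLM_apply]
  rw [e1, e2]
  have := SchwartzMap.integral_smul_deriv_right_eq_neg_left (hc.toSchwartzMap hφ) s
  simp only [HasCompactSupport.toSchwartzMap_toFun] at this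
  rw [eq_neg_iff_add_eq_zero, add_comm, ← eq_neg_iff_add_eq_zero]
  exact this

theorem dense_H1 : Dense (H1 : Set L2) := by
  refine (SchwartzMap.denseRange_toLpCLM (E := ℝ) (F := ℂ) (μ := volume) (p := 2)
    ENNReal.ofNat_ne_top).mono ?_
  rintro _ ⟨s, rfl⟩
  exact schwartz_mem_H1 s

theorem schrodingerGraph_single_valued (μ : SignedMeasure ℝ) (p : L2 × L2)
    (hp : p ∈ schrodingerGraph μ) (h0 : p.1 = 0) : p.2 = 0 := by
  obtain ⟨f, hf, h⟩ := hp
  have hf0 : f = (0 : ℂ) • f := by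
    rw [zero_smul]
    exact Subtype.ext (hf.trans h0)
  refine dense_H1.eq_zero_of_inner_right ℂ fun g hg => ?_
  rw [h ⟨g, hg⟩, hf0, form_smul_left, zero_mul]

/-- The operator `-Δ + μ` in `L²(ℝ)`, associated with the closed semibounded form `a_μ` by Kato's
first representation theorem: its domain consists of those `f ∈ H¹(ℝ)` for which there is
`u ∈ L²(ℝ)` with `⟨u, g⟩ = a_μ(f, g)` for all `g ∈ H¹(ℝ)`, and it maps `f` to this unique `u`. -/
def schrodinger (μ : SignedMeasure ℝ) : L2 →ₗ.[ℂ] L2 :=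
  (schrodingerGraph μ).toLinearPMap

theorem schrodinger_graph (μ : SignedMeasure ℝ) :
    (schrodinger μ).graph = schrodingerGraph μ :=
  Submodule.toLinearPMap_graph_eq _ (schrodingerGraph_single_valued μ)

/-- `E` is an eigenvalue of the (unbounded) operator `A`. -/
def IsEigenvalue (A : L2 →ₗ.[ℂ] L2) (E : ℂ) : Prop :=
  ∃ f : A.domain, (f : L2) ≠ 0 ∧ A f = E • (f : L2)

/-- The finite signed measure `∑ j, α j • δ_{x j}`. -/
def pointMeasure {n : ℕ} (α x : Fin n → ℝ) : SignedMeasure ℝ :=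
  ∑ j, VectorMeasure.dirac (x j) (α j)

end PointInteraction

end

noncomputable section

namespace PointInteraction

/-! The trial function `exp (-κ₀ |· - x k|)` with `κ₀ = -α k / 2` is the ground state of `-Δ + α k
δ_{x k}` alone. Its form value is `κ₀ + ∑ j, α j * exp (-2 κ₀ |x j - x k|)`, which is the left side
of the hypothesis times the positive factor `exp (α k * x k)`, so it is negative.

A negative form value is turned into an eigenvalue by a finite-dimensional argument, without
spectral theory. For `κ > 0` give `H¹` the energy inner product `⟨f', g'⟩ + κ² ⟨f, g⟩`. Up to the
factor `2κ`, the function `exp (-κ |· - y|)` represents evaluation at `y` (`inner_energyMap_expH1`).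
Let `M = expMatrix κ x` and `f_c = ∑ c j exp (-κ |· - x j|)`. Then `f_c` has values `M c` at the
points and energy `2κ c·Mc`, so the form of `-Δ + μ + κ²` on `f_c` is `q_κ(c) = 2κ c·Mc + ∑ α j
(Mc)_j²` (`reducedForm`).

For small `κ` the shifted form is still negative on the trial function. Replacing that function by
the `f_c` with the same values at the points only lowers the energy, so `q_κ` takes a negative value
(`exists_reducedForm_neg`). For large `κ` it is positive definite (`reducedForm_pos`). By
compactness there is a threshold `κ` at which `q_κ` is nonnegative and vanishes at some `c ≠ 0`
(`exists_nonneg_eq_zero_of_quadratic`). That `c` is a minimizer, hence stationary. Since `M` is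
invertible, stationarity reads `2κ c j + α j (Mc)_j = 0`, which says exactly that `f_c` is an
eigenfunction with eigenvalue `-κ²`. -/

/-! ### Integration against a decaying exponential on a half-line. -/

theorem integrableOn_Ioi_exp_neg_mul {κ : ℝ} (hκ : 0 < κ) (c : ℝ) :
    IntegrableOn (fun x => Real.exp (-(κ * x))) (Ioi c) := by
  simpa only [neg_mul] using integrableOn_exp_mul_Ioi (neg_lt_zero.2 hκ) c

theorem integral_Ioi_mul_exp_neg_mul {κ : ℝ} (hκ : 0 < κ) (c : ℝ) :
    ∫ x in Ioi c, κ * Real.exp (-(κ * x)) = Real.exp (-(κ * c)) := by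
  have := integral_exp_mul_Ioi (neg_lt_zero.2 hκ) c
  simp only [neg_mul] at this
  rw [integral_const_mul, this]
  field_simp

/-- Fubini's theorem on a half-line: integration by parts against a decaying exponential. -/
theorem integral_Ioi_exp_smul_primitive {κ : ℝ} (hκ : 0 < κ) {h : ℝ → ℂ}
    (hh : IntegrableOn (fun t => Real.exp (-(κ * t)) • h t) (Ioi 0)) :
    ∫ x in Ioi (0 : ℝ), (κ * Real.exp (-(κ * x))) • (∫ t in (0 : ℝ)..x, h t)
      = ∫ t in Ioi (0 : ℝ), Real.exp (-(κ * t)) • h t := by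
  set k : ℝ → ℝ := fun x => κ * Real.exp (-(κ * x)) with hk
  have hk0 : ∀ x, 0 ≤ k x := fun x => by positivity
  have hki : ∀ c, IntegrableOn k (Ioi c) := fun c =>
    (integrableOn_Ioi_exp_neg_mul hκ c).const_mul κ
  have hkI : ∀ c, ∫ x in Ioi c, k x = Real.exp (-(κ * c)) := integral_Ioi_mul_exp_neg_mul hκ
  set ν : Measure ℝ := volume.restrict (Ioi 0) with hν
  -- Only the weighted function is assumed integrable; measurability of `h` comes from multiplying
  -- the weight away.
  have hm : AEStronglyMeasurable h ν := by
    have he : Continuous fun t : ℝ => Real.exp (κ * t) := by fun_prop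
    have h1 : AEStronglyMeasurable
        (fun t => Real.exp (κ * t) • (Real.exp (-(κ * t)) • h t)) ν :=
      he.aestronglyMeasurable.smul hh.1
    refine h1.congr (Filter.Eventually.of_forall fun t => ?_)
    simp only [smul_smul, ← Real.exp_add, add_neg_cancel, Real.exp_zero, one_smul]
  -- The double integral runs over `0 < t < x`; integrating `k` over `x > t` first leaves `exp (-(κ
  -- * t))`.
  set S : Set (ℝ × ℝ) := {p | p.2 < p.1} with hS
  have hSm : MeasurableSet S := measurableSet_lt measurable_snd measurable_fst
  set F : ℝ × ℝ → ℂ := S.indicator fun p => k p.1 • h p.2 with hF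
  have hFx : ∀ t, (fun x => F (x, t)) = (Ioi t).indicator fun x => k x • h t := fun t => rfl
  have hFt : ∀ x, (fun t => F (x, t)) = (Iio x).indicator fun t => k x • h t := fun x => rfl
  have hFm : AEStronglyMeasurable F (ν.prod ν) := by
    refine AEStronglyMeasurable.indicator ?_ hSm
    exact (AEStronglyMeasurable.comp_fst (f := k)
      (Continuous.aestronglyMeasurable (by fun_prop))).smul hm.comp_snd
  have hinter : ∀ t ∈ Ioi (0 : ℝ), Ioi (0 : ℝ) ∩ Ioi t = Ioi t := fun t ht =>
    inter_eq_right.2 (Ioi_subset_Ioi (le_of_lt ht))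
  have hFi : Integrable F (ν.prod ν) := by
    refine (integrable_prod_iff' hFm).2 ⟨Filter.Eventually.of_forall fun t => ?_, ?_⟩
    · rw [hFx]
      exact ((hki 0).smul_const (h t)).indicator measurableSet_Ioi
    · refine hh.norm.congr ?_
      filter_upwards [ae_restrict_mem measurableSet_Ioi] with t ht
      have : ∀ x, ‖F (x, t)‖ = (Ioi t).indicator (fun x => k x * ‖h t‖) x := fun x => by
        rw [congrFun (hFx t) x, norm_indicator_eq_indicator_norm]
        simp only [norm_smul, Real.norm_of_nonneg (hk0 _)]
      simp only [this]
      rw [hν, setIntegral_indicator measurableSet_Ioi, hinter t ht, integral_mul_const, hkI,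
        norm_smul, Real.norm_of_nonneg (Real.exp_pos _).le]
  have hsw := integral_integral_swap (f := fun x t => F (x, t)) hFi
  calc _ = ∫ x, ∫ t, F (x, t) ∂ν ∂ν := by
        refine setIntegral_congr_fun measurableSet_Ioi fun x hx => ?_
        simp only [hFt]
        rw [hν, setIntegral_indicator measurableSet_Iio, integral_smul, Ioi_inter_Iio,
          intervalIntegral.integral_of_le (le_of_lt hx), integral_Ioc_eq_integral_Ioo]
    _ = _ := by
        rw [hsw]
        refine setIntegral_congr_fun measurableSet_Ioi fun t ht => ?_
        simp only [hFx]
        rw [hν, setIntegral_indicator measurableSet_Ioi, hinter t ht, integral_smul_const, hkI]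

/-! ### The functions `exp (-κ |· - y|)` in `H¹(ℝ)`. -/

/-- The function `x ↦ exp (-κ |x - y|)`. -/
def expFun (κ y x : ℝ) : ℝ := Real.exp (-(κ * |x - y|))

/-- The derivative of `expFun κ y` away from `y`. -/
def expFunDeriv (κ y x : ℝ) : ℝ := (if x ≤ y then κ else -κ) * expFun κ y x

theorem expFun_pos (κ y x : ℝ) : 0 < expFun κ y x := Real.exp_pos _

theorem expFun_symm (κ y x : ℝ) : expFun κ y x = expFun κ x y := by
  rw [expFun, expFun, abs_sub_comm]

theorem expFun_self (κ y : ℝ) : expFun κ y y = 1 := by simp [expFun]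

theorem continuous_expFun (κ y : ℝ) : Continuous (expFun κ y) := by
  unfold expFun; fun_prop

theorem expFun_sq (κ y x : ℝ) : expFun κ y x ^ 2 = expFun (2 * κ) y x := by
  rw [expFun, expFun, ← Real.exp_nat_mul]
  congr 1
  push_cast
  ring

theorem measurable_expFunDeriv (κ y : ℝ) : Measurable (expFunDeriv κ y) :=
  (Measurable.ite measurableSet_Iic measurable_const measurable_const).mul
    (continuous_expFun κ y).measurable

theorem abs_expFunDeriv {κ : ℝ} (hκ : 0 < κ) (y x : ℝ) :
    |expFunDeriv κ y x| = κ * expFun κ y x := by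
  rw [expFunDeriv, abs_mul, abs_of_pos (expFun_pos κ y x)]
  split_ifs
  · rw [abs_of_pos hκ]
  · rw [abs_neg, abs_of_pos hκ]

theorem hasDerivAt_expFun (κ : ℝ) {y x : ℝ} (h : x ≠ y) :
    HasDerivAt (expFun κ y) (expFunDeriv κ y x) x := by
  rcases lt_or_gt_of_ne h with hlt | hgt
  · have h1 : HasDerivAt (fun x => Real.exp (κ * (x - y))) (Real.exp (κ * (x - y)) * (κ * 1)) x :=
      (((hasDerivAt_id x).sub_const y).const_mul κ).exp
    have h2 : expFun κ y =ᶠ[nhds x] fun x => Real.exp (κ * (x - y)) := by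
      filter_upwards [Iio_mem_nhds hlt] with z hz
      rw [expFun, abs_of_neg (sub_neg.2 hz)]
      congr 1; ring
    refine (h1.congr_of_eventuallyEq h2).congr_deriv ?_
    rw [expFunDeriv, if_pos hlt.le, h2.self_of_nhds]; ring
  · have h1 : HasDerivAt (fun x => Real.exp (-κ * (x - y)))
        (Real.exp (-κ * (x - y)) * (-κ * 1)) x :=
      (((hasDerivAt_id x).sub_const y).const_mul (-κ)).exp
    have h2 : expFun κ y =ᶠ[nhds x] fun x => Real.exp (-κ * (x - y)) := by
      filter_upwards [Ioi_mem_nhds hgt] with z hz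
      rw [expFun, abs_of_pos (sub_pos.2 hz)]
      congr 1; ring
    refine (h1.congr_of_eventuallyEq h2).congr_deriv ?_
    rw [expFunDeriv, if_neg (not_le.2 hgt), h2.self_of_nhds]; ring

theorem integrable_expFun {κ : ℝ} (hκ : 0 < κ) (y : ℝ) : Integrable (expFun κ y) := by
  suffices h : Integrable (expFun κ 0) by
    refine (h.comp_sub_right y).congr (Filter.Eventually.of_forall fun x => ?_)
    simp [expFun]
  have h1 : IntegrableOn (expFun κ 0) (Ioi 0) :=
    (integrableOn_Ioi_exp_neg_mul hκ 0).congr_fun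
      (fun x hx => by simp [expFun, abs_of_pos (mem_Ioi.1 hx)]) measurableSet_Ioi
  have h2 : IntegrableOn (expFun κ 0) (Iic 0) := by
    rw [← integrableOn_Ici_iff_integrableOn_Ioi, ← integrable_indicator_iff measurableSet_Ici] at h1
    rw [← integrable_indicator_iff measurableSet_Iic]
    refine h1.comp_neg.congr (Filter.Eventually.of_forall fun x => ?_)
    by_cases hx : x ≤ 0
    · simp [hx, expFun]
    · simp [hx]
  rw [← integrableOn_univ, ← Iic_union_Ioi (a := (0 : ℝ))]
  exact h2.union h1

theorem memLp_expFun {κ : ℝ} (hκ : 0 < κ) (y : ℝ) :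
    MemLp (fun x => (expFun κ y x : ℂ)) 2 volume := by
  refine (memLp_two_iff_integrable_sq_norm (Complex.continuous_ofReal.comp
    (continuous_expFun κ y)).aestronglyMeasurable).2 ?_
  refine (integrable_expFun (mul_pos two_pos hκ) y).congr (Filter.Eventually.of_forall fun x => ?_)
  change expFun (2 * κ) y x = ‖(expFun κ y x : ℂ)‖ ^ 2
  rw [← expFun_sq, Complex.norm_real, Real.norm_eq_abs, sq_abs]

theorem memLp_expFunDeriv {κ : ℝ} (hκ : 0 < κ) (y : ℝ) :
    MemLp (fun x => (expFunDeriv κ y x : ℂ)) 2 volume := by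
  refine (memLp_expFun hκ y).of_le_mul (c := κ)
    (Complex.measurable_ofReal.comp (measurable_expFunDeriv κ y)).aestronglyMeasurable
    (Filter.Eventually.of_forall fun x => ?_)
  simp only [Complex.norm_real, Real.norm_eq_abs, abs_expFunDeriv hκ,
    abs_of_pos (expFun_pos κ y x), le_refl]

theorem integral_deriv_eq_zero_of_hasCompactSupport {φ : ℝ → ℝ} (hφ : ContDiff ℝ ∞ φ)
    (hc : HasCompactSupport φ) : ∫ x, deriv φ x = 0 := by
  simpa using integral_of_hasDerivAt_of_tendsto (f := φ) (f' := deriv φ)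
    (fun x => (hφ.differentiable (by simp) x).hasDerivAt)
    ((hφ.continuous_deriv (by simp)).integrable_of_hasCompactSupport hc.deriv)
    (hc.is_zero_at_infty.mono_left _root_.atBot_le_cocompact)
    (hc.is_zero_at_infty.mono_left _root_.atTop_le_cocompact)

/-- The function is continuous and differentiable off one point, so it is a primitive of
`expFunDeriv` plus a constant; the constant contributes nothing because `∫ φ' = 0`. -/
theorem isWeakDeriv_expFun {κ : ℝ} (hκ : 0 < κ) (y : ℝ) :
    IsWeakDeriv ((memLp_expFun hκ y).toLp _) ((memLp_expFunDeriv hκ y).toLp _) := by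
  intro φ hφ hc
  have hd : LocallyIntegrable (fun x => (expFunDeriv κ y x : ℂ)) volume :=
    (memLp_expFunDeriv hκ y).locallyIntegrable (by norm_num)
  have hcont : Continuous fun x => (expFun κ y x : ℂ) :=
    Complex.continuous_ofReal.comp (continuous_expFun κ y)
  have hprim : ∀ x, (expFun κ y x : ℂ)
      = (∫ t in (0 : ℝ)..x, (expFunDeriv κ y t : ℂ)) + (expFun κ y 0 : ℂ) := by
    intro x
    rw [integral_eq_of_hasDerivAt_off_countable (fun x => (expFun κ y x : ℂ)) _
      (countable_singleton y) hcont.continuousOn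
      (fun t ht => (hasDerivAt_expFun κ ht.2).ofReal_comp)
      (hd.integrableOn_isCompact isCompact_uIcc).intervalIntegrable, sub_add_cancel]
  have hPc : Continuous fun x => ∫ t in (0 : ℝ)..x, (expFunDeriv κ y t : ℂ) :=
    intervalIntegral.continuous_primitive
      (fun a b => (hd.integrableOn_isCompact isCompact_uIcc).intervalIntegrable) 0
  have e1 : ∫ x, deriv φ x • ((memLp_expFun hκ y).toLp _ : L2) x
      = ∫ x, (deriv φ x • (∫ t in (0 : ℝ)..x, (expFunDeriv κ y t : ℂ))
        + deriv φ x • (expFun κ y 0 : ℂ)) := by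
    refine integral_congr_ae ?_
    filter_upwards [(memLp_expFun hκ y).coeFn_toLp] with x hx
    rw [hx, ← smul_add, ← hprim]
  have e2 : ∫ x, φ x • ((memLp_expFunDeriv hκ y).toLp _ : L2) x
      = ∫ x, φ x • (expFunDeriv κ y x : ℂ) := by
    refine integral_congr_ae ?_
    filter_upwards [(memLp_expFunDeriv hκ y).coeFn_toLp] with x hx
    rw [hx]
  rw [e1, e2, integral_add (integrable_deriv_test_smul hφ hc hPc.locallyIntegrable)
    (integrable_deriv_test_smul hφ hc continuous_const.locallyIntegrable),
    integral_deriv_smul_primitive hd hφ hc, integral_smul_const,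
    integral_deriv_eq_zero_of_hasCompactSupport hφ hc, zero_smul, add_zero]

/-- The function `x ↦ exp (-κ |x - y|)` as an element of `H¹(ℝ)`. -/
def expH1 {κ : ℝ} (hκ : 0 < κ) (y : ℝ) : H1 :=
  ⟨(memLp_expFun hκ y).toLp _, _, isWeakDeriv_expFun hκ y⟩

theorem coe_expH1_ae_eq {κ : ℝ} (hκ : 0 < κ) (y : ℝ) :
    (expH1 hκ y : L2) =ᵐ[volume] fun x => (expFun κ y x : ℂ) :=
  (memLp_expFun hκ y).coeFn_toLp

theorem weakDeriv_expH1 {κ : ℝ} (hκ : 0 < κ) (y : ℝ) :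
    weakDeriv (expH1 hκ y) = (memLp_expFunDeriv hκ y).toLp _ :=
  (weakDeriv_spec _).unique (isWeakDeriv_expFun hκ y)

theorem weakDeriv_expH1_ae_eq {κ : ℝ} (hκ : 0 < κ) (y : ℝ) :
    weakDeriv (expH1 hκ y) =ᵐ[volume] fun x => (expFunDeriv κ y x : ℂ) := by
  rw [weakDeriv_expH1]
  exact (memLp_expFunDeriv hκ y).coeFn_toLp

theorem contRep_expH1 {κ : ℝ} (hκ : 0 < κ) (y : ℝ) :
    contRep (expH1 hκ y) = fun x => (expFun κ y x : ℂ) :=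
  contRep_unique _ (Complex.continuous_ofReal.comp (continuous_expFun κ y))
    (coe_expH1_ae_eq hκ y).symm

theorem norm_weakDeriv_expH1 {κ : ℝ} (hκ : 0 < κ) (y : ℝ) :
    ‖weakDeriv (expH1 hκ y)‖ = κ * ‖(expH1 hκ y : L2)‖ := by
  have h : ‖weakDeriv (expH1 hκ y)‖ = ‖(κ : ℂ) • (expH1 hκ y : L2)‖ := by
    rw [Lp.norm_def, Lp.norm_def]
    congr 1
    refine eLpNorm_congr_norm_ae ?_
    filter_upwards [weakDeriv_expH1_ae_eq hκ y, coe_expH1_ae_eq hκ y,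
      Lp.coeFn_smul (κ : ℂ) (expH1 hκ y : L2)] with x h1 h2 h3
    rw [h1, h3, Pi.smul_apply, h2, norm_smul, Complex.norm_real, Complex.norm_real,
      Complex.norm_real, Real.norm_eq_abs, Real.norm_eq_abs, Real.norm_eq_abs, abs_expFunDeriv hκ,
      abs_of_pos hκ, abs_of_pos (expFun_pos κ y x)]
  rw [h, norm_smul, Complex.norm_real, Real.norm_of_nonneg hκ.le]

/-! ### The Green function identity. -/

theorem integrableOn_Ioi_add_and_sub {F : ℝ → ℂ} (hF : Integrable F) (y : ℝ) :
    IntegrableOn (fun x => F (y + x)) (Ioi 0) ∧ IntegrableOn (fun x => F (y - x)) (Ioi 0) :=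
  ⟨(hF.comp_add_left y).integrableOn, (hF.comp_sub_left y).integrableOn⟩

theorem integral_eq_Ioi_add_Ioi {F : ℝ → ℂ} (hF : Integrable F) (y : ℝ) :
    ∫ x, F x = (∫ x in Ioi (0 : ℝ), F (y + x)) + ∫ x in Ioi (0 : ℝ), F (y - x) := by
  have h := hF.comp_add_left y
  have e := integral_comp_neg_Ioi 0 fun x => F (y + x)
  simp only [← sub_eq_add_neg, neg_zero] at e
  rw [← integral_add_left_eq_self F y, e,
    ← intervalIntegral.integral_Iic_add_Ioi h.integrableOn h.integrableOn, add_comm]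

theorem integrable_expFun_mul {κ : ℝ} (hκ : 0 < κ) (y : ℝ) {h : ℝ → ℂ} (hh : MemLp h 2 volume) :
    Integrable fun x => (expFun κ y x : ℂ) * h x :=
  (memLp_expFun hκ y).integrable_mul hh

theorem integrable_expFunDeriv_mul {κ : ℝ} (hκ : 0 < κ) (y : ℝ) {h : ℝ → ℂ}
    (hh : MemLp h 2 volume) : Integrable fun x => (expFunDeriv κ y x : ℂ) * h x :=
  (memLp_expFunDeriv hκ y).integrable_mul hh

theorem expFun_add_left (κ y : ℝ) {x : ℝ} (hx : 0 < x) :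
    expFun κ y (y + x) = Real.exp (-(κ * x)) := by
  rw [expFun, add_sub_cancel_left, abs_of_pos hx]

theorem expFun_sub_left (κ y : ℝ) {x : ℝ} (hx : 0 < x) :
    expFun κ y (y - x) = Real.exp (-(κ * x)) := by
  rw [expFun, sub_sub_cancel_left, abs_neg, abs_of_pos hx]

/-- `exp (-κ |· - y|)` is `2κ` times the Green function of `-d²/dx² + κ²`. -/
theorem integral_expFunDeriv_mul_weakDeriv {κ : ℝ} (hκ : 0 < κ) (y : ℝ) (g : H1) :
    (∫ x, (expFunDeriv κ y x : ℂ) * weakDeriv g x)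
      + κ ^ 2 * ∫ x, (expFun κ y x : ℂ) * contRep g x = 2 * κ * contRep g y := by
  have hG : MemLp (contRep g) 2 volume := (memLp_congr_ae (contRep_ae_eq g)).2 (Lp.memLp _)
  have hW : MemLp (weakDeriv g : ℝ → ℂ) 2 volume := Lp.memLp _
  have iG := integrable_expFun_mul hκ y hG
  have iW := integrable_expFun_mul hκ y hW
  have iD := integrable_expFunDeriv_mul hκ y hW
  obtain ⟨iG1, iG2⟩ := integrableOn_Ioi_add_and_sub iG y
  obtain ⟨iW1, iW2⟩ := integrableOn_Ioi_add_and_sub iW y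
  rw [integral_eq_Ioi_add_Ioi iG y, integral_eq_Ioi_add_Ioi iD y]
  have eadd : ∀ h : ℝ → ℂ, EqOn (fun x => (expFun κ y (y + x) : ℂ) * h x)
      (fun x => Real.exp (-(κ * x)) • h x) (Ioi 0) := fun h x hx => by
    simp only [expFun_add_left κ y hx, Complex.real_smul]
  have esub : ∀ h : ℝ → ℂ, EqOn (fun x => (expFun κ y (y - x) : ℂ) * h x)
      (fun x => Real.exp (-(κ * x)) • h x) (Ioi 0) := fun h x hx => by
    simp only [expFun_sub_left κ y hx, Complex.real_smul]
  have edadd : EqOn (fun x => (expFunDeriv κ y (y + x) : ℂ) * weakDeriv g (y + x))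
      (fun x => -κ * (Real.exp (-(κ * x)) • weakDeriv g (y + x))) (Ioi 0) := fun x hx => by
    have : ¬ y + x ≤ y := by simpa using hx
    simp only [expFunDeriv, if_neg this, expFun_add_left κ y hx, Complex.real_smul]
    push_cast; ring
  have edsub : EqOn (fun x => (expFunDeriv κ y (y - x) : ℂ) * weakDeriv g (y - x))
      (fun x => κ * (Real.exp (-(κ * x)) • weakDeriv g (y - x))) (Ioi 0) := fun x hx => by
    have : y - x ≤ y := by linarith [mem_Ioi.1 hx]
    simp only [expFunDeriv, if_pos this, expFun_sub_left κ y hx, Complex.real_smul]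
    push_cast; ring
  rw [setIntegral_congr_fun measurableSet_Ioi edadd, setIntegral_congr_fun measurableSet_Ioi edsub,
    setIntegral_congr_fun measurableSet_Ioi (eadd fun x => contRep g (y + x)),
    setIntegral_congr_fun measurableSet_Ioi (esub fun x => contRep g (y - x)),
    integral_const_mul, integral_const_mul]
  replace iG1 := iG1.congr_fun (eadd fun x => contRep g (y + x)) measurableSet_Ioi
  replace iG2 := iG2.congr_fun (esub fun x => contRep g (y - x)) measurableSet_Ioi
  have f1 := integral_Ioi_exp_smul_primitive hκ
    (iW1.congr_fun (eadd fun x => weakDeriv g (y + x)) measurableSet_Ioi)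
  have f2 := integral_Ioi_exp_smul_primitive hκ
    (iW2.congr_fun (esub fun x => weakDeriv g (y - x)) measurableSet_Ioi)
  -- On both sides of `y` the primitive of `g'` is an increment of `g` from `y`, with opposite
  -- signs. In the final sum the `κ²` terms therefore cancel, while each side contributes `κ *
  -- contRep g y`.
  have p1 : ∀ x, ∫ t in (0 : ℝ)..x, weakDeriv g (y + t) = contRep g (y + x) - contRep g y := by
    intro x
    rw [intervalIntegral.integral_comp_add_left (fun t => weakDeriv g t), contRep_sub, add_zero]
  have p2 : ∀ x, ∫ t in (0 : ℝ)..x, weakDeriv g (y - t) = contRep g y - contRep g (y - x) := by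
    intro x
    rw [intervalIntegral.integral_comp_sub_left (fun t => weakDeriv g t), contRep_sub, sub_zero]
  have ik : IntegrableOn (fun x => (κ * Real.exp (-(κ * x))) • contRep g y) (Ioi 0) :=
    ((integrableOn_Ioi_exp_neg_mul hκ 0).const_mul κ).smul_const _
  have hk : ∫ x in Ioi (0 : ℝ), (κ * Real.exp (-(κ * x))) • contRep g y = contRep g y := by
    rw [integral_smul_const, integral_Ioi_mul_exp_neg_mul hκ]; simp
  simp only [p1, p2, smul_sub] at f1 f2
  simp only [mul_smul κ _ (contRep g (_ + _)), mul_smul κ _ (contRep g (_ - _))] at f1 f2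
  rw [integral_sub (f := fun x => κ • Real.exp (-(κ * x)) • contRep g (y + x)) (iG1.smul κ) ik,
    hk, integral_smul, Complex.real_smul] at f1
  rw [integral_sub (g := fun x => κ • Real.exp (-(κ * x)) • contRep g (y - x)) ik (iG2.smul κ),
    hk, integral_smul, Complex.real_smul] at f2
  rw [← f1, ← f2]
  ring

/-! ### The energy inner product and its reproducing kernel. -/

/-- The embedding `f ↦ (f', κ f)`, whose inner product is `∫ f' (conj g') + κ² ∫ f (conj g)`. -/
def energyMap (κ : ℝ) : H1 →ₗ[ℂ] WithLp 2 (L2 × L2) where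
  toFun f := WithLp.toLp 2 (weakDeriv f, (κ : ℂ) • (f : L2))
  map_add' f g := by
    rw [weakDeriv_add, Submodule.coe_add, smul_add, ← WithLp.toLp_add, Prod.mk_add_mk]
  map_smul' c f := by
    rw [weakDeriv_smul, Submodule.coe_smul, smul_comm, ← WithLp.toLp_smul, Prod.smul_mk,
      RingHom.id_apply]

theorem inner_energyMap (κ : ℝ) (f g : H1) : ⟪energyMap κ f, energyMap κ g⟫_ℂ
    = ⟪weakDeriv f, weakDeriv g⟫_ℂ + κ ^ 2 * ⟪(f : L2), (g : L2)⟫_ℂ := by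
  rw [WithLp.prod_inner_apply]
  simp only [energyMap, LinearMap.coe_mk, AddHom.coe_mk, inner_smul_left, inner_smul_right,
    Complex.conj_ofReal]
  ring

theorem norm_energyMap_sq (κ : ℝ) (f : H1) :
    ‖energyMap κ f‖ ^ 2 = ‖weakDeriv f‖ ^ 2 + κ ^ 2 * ‖(f : L2)‖ ^ 2 := by
  rw [WithLp.prod_norm_sq_eq_of_L2]
  change ‖weakDeriv f‖ ^ 2 + ‖(κ : ℂ) • (f : L2)‖ ^ 2 = _
  rw [norm_smul, Complex.norm_real, Real.norm_eq_abs, mul_pow, sq_abs]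

theorem inner_energyMap_expH1 {κ : ℝ} (hκ : 0 < κ) (y : ℝ) (g : H1) :
    ⟪energyMap κ (expH1 hκ y), energyMap κ g⟫_ℂ = 2 * κ * contRep g y := by
  rw [inner_energyMap, ← integral_expFunDeriv_mul_weakDeriv hκ, ← integral_mul_conj,
    ← integral_mul_conj]
  congr 1
  · refine integral_congr_ae ?_
    filter_upwards [weakDeriv_expH1_ae_eq hκ y] with x hx
    rw [hx, Complex.conj_ofReal, mul_comm]
  · congr 1
    refine integral_congr_ae ?_
    filter_upwards [coe_expH1_ae_eq hκ y, contRep_ae_eq g] with x hx hx'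
    rw [hx, hx', Complex.conj_ofReal, mul_comm]

theorem norm_energyMap_expH1_self_sq {κ : ℝ} (hκ : 0 < κ) (y : ℝ) :
    ‖energyMap κ (expH1 hκ y)‖ ^ 2 = 2 * κ := by
  have h := inner_energyMap_expH1 hκ y (expH1 hκ y)
  rw [contRep_expH1, inner_self_eq_norm_sq_to_K] at h
  simp only [expFun_self, Complex.coe_algebraMap, Complex.ofReal_one, mul_one] at h
  exact_mod_cast h

/-- The decay rate `κ₀` of the function need not match the energy parameter `κ`. The matched case,
with `‖f'‖ = κ₀ ‖f‖`, gives `‖f‖² = 1 / κ₀`, which settles all `κ`. -/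
theorem norm_energyMap_expH1_sq (κ : ℝ) {κ₀ : ℝ} (hκ₀ : 0 < κ₀) (y : ℝ) :
    ‖energyMap κ (expH1 hκ₀ y)‖ ^ 2 = κ₀ + κ ^ 2 / κ₀ := by
  have h := norm_energyMap_expH1_self_sq hκ₀ y
  rw [norm_energyMap_sq, norm_weakDeriv_expH1] at h ⊢
  have h2 : ‖(expH1 hκ₀ y : L2)‖ ^ 2 = 1 / κ₀ := by
    rw [eq_div_iff hκ₀.ne']
    have : κ₀ * (‖(expH1 hκ₀ y : L2)‖ ^ 2 * κ₀) = κ₀ * 1 := by linarith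
    exact mul_left_cancel₀ hκ₀.ne' this
  rw [mul_pow, h2]
  field_simp

/-! ### The threshold at which a family of quadratic forms loses definiteness. -/

open Matrix Topology Filter

/-- If a continuous family of quadratic forms is negative somewhere at `a` and positive definite
at `b`, then one of its members on `[a, b]` is positive semidefinite with nontrivial kernel. -/
theorem exists_nonneg_eq_zero_of_quadratic {n : ℕ} {q : ℝ → (Fin n → ℝ) → ℝ} {a b : ℝ}
    (hq : Continuous fun p : ℝ × (Fin n → ℝ) => q p.1 p.2)
    (hs : ∀ κ t c, q κ (t • c) = t ^ 2 * q κ c) (hab : a ≤ b)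
    (ha : ∃ c, q a c < 0) (hb : ∀ c, c ≠ 0 → 0 < q b c) :
    ∃ κ, a ≤ κ ∧ ∃ c, c ≠ 0 ∧ q κ c = 0 ∧ ∀ d, 0 ≤ q κ d := by
  have hq0 : ∀ κ, q κ 0 = 0 := fun κ => by simpa using hs κ 0 0
  have normalize : ∀ κ d, q κ d < 0 → ∃ e ∈ Metric.sphere (0 : Fin n → ℝ) 1, q κ e ≤ 0 := by
    intro κ d hd
    have hd0 : d ≠ 0 := by
      rintro rfl
      exact hd.ne (hq0 κ)
    refine ⟨‖d‖⁻¹ • d, by simp [norm_smul, norm_ne_zero_iff.2 hd0], ?_⟩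
    rw [hs]
    exact mul_nonpos_of_nonneg_of_nonpos (sq_nonneg _) hd.le
  -- Parameters paired with unit vectors on which the form is nonpositive; the largest such
  -- parameter is the threshold.
  set K : Set (ℝ × (Fin n → ℝ)) :=
    (Icc a b ×ˢ Metric.sphere 0 1) ∩ {p | q p.1 p.2 ≤ 0} with hK
  have hKc : IsCompact K :=
    (isCompact_Icc.prod (isCompact_sphere _ _)).inter_right (isClosed_le hq continuous_const)
  have hKn : K.Nonempty := by
    obtain ⟨c, hc⟩ := ha
    obtain ⟨e, he, hqe⟩ := normalize a c hc
    exact ⟨(a, e), ⟨⟨left_mem_Icc.2 hab, he⟩, hqe⟩⟩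
  obtain ⟨⟨κ, c⟩, ⟨⟨hκ, hc⟩, hqc⟩, hmax⟩ := hKc.exists_isMaxOn hKn continuous_fst.continuousOn
  replace hqc : q κ c ≤ 0 := hqc
  have hc0 : c ≠ 0 := ne_zero_of_mem_unit_sphere ⟨c, hc⟩
  have hlt : κ < b := lt_of_le_of_ne hκ.2 fun h => (hb c hc0).not_ge (h ▸ hqc)
  have hnn : ∀ d, 0 ≤ q κ d := by
    intro d
    have hcont : Continuous fun κ => q κ d :=
      hq.comp (continuous_id.prodMk continuous_const)
    -- Beyond the maximal `κ` no form in the family takes a negative value, and this passes to the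
    -- limit from the right.
    refine ge_of_tendsto (hcont.continuousWithinAt (s := Ioi κ) (x := κ)) ?_
    filter_upwards [Ioc_mem_nhdsGT hlt] with μ hμ
    by_contra hneg
    obtain ⟨e, he, hqe⟩ := normalize μ d (not_le.1 hneg)
    exact (hmax (a := (μ, e)) ⟨⟨⟨hκ.1.trans hμ.1.le, hμ.2⟩, he⟩, hqe⟩).not_gt hμ.1
  exact ⟨κ, hκ.1, c, hc0, le_antisymm hqc (hnn c), hnn⟩

/-! ### The exponential matrix and its invertibility. -/

/-- The matrix with entries `exp (-κ |x i - x j|)`. -/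
def expMatrix {n : ℕ} (κ : ℝ) (x : Fin n → ℝ) : Matrix (Fin n) (Fin n) ℝ :=
  Matrix.of fun i j => expFun κ (x j) (x i)

theorem expMatrix_mulVec {n : ℕ} (κ : ℝ) (x c : Fin n → ℝ) (i : Fin n) :
    (expMatrix κ x *ᵥ c) i = ∑ j, expFun κ (x j) (x i) * c j := rfl

theorem dotProduct_expMatrix_mulVec_comm {n : ℕ} (κ : ℝ) (x c d : Fin n → ℝ) :
    d ⬝ᵥ expMatrix κ x *ᵥ c = c ⬝ᵥ expMatrix κ x *ᵥ d := by
  have h : (expMatrix κ x)ᵀ = expMatrix κ x := by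
    ext i j
    exact expFun_symm κ (x i) (x j)
  rw [dotProduct_mulVec, ← mulVec_transpose, h, dotProduct_comm]

theorem continuous_expMatrix_mulVec {n : ℕ} (x : Fin n → ℝ) :
    Continuous fun p : ℝ × (Fin n → ℝ) => expMatrix p.1 x *ᵥ p.2 := by
  refine continuous_pi fun i => ?_
  simp only [expMatrix_mulVec, expFun]
  fun_prop

/-- Elimination from the last index down. To the left of `x p`, passing from row `p = m - 1` to row
`m` multiplies every entry by the same `r = exp (-κ (x m - x p))`. Subtracting `r` times row `p`
from row `m` thus removes all columns `j < m`, and columns `j > m` vanish by induction. -/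
theorem expMatrix_mulVec_injective {n : ℕ} {κ : ℝ} (hκ : 0 < κ) {x : Fin n → ℝ}
    (hx : StrictMono x) {c : Fin n → ℝ} (hc : expMatrix κ x *ᵥ c = 0) : c = 0 := by
  have hrow : ∀ i, ∑ j, expFun κ (x j) (x i) * c j = 0 := fun i => congrFun hc i
  funext m
  induction m using WellFoundedGT.induction with
  | ind m ih =>
    by_cases hm : (m : ℕ) = 0
    · have h := hrow m
      rw [Finset.sum_eq_single m] at h
      · simpa [expFun_self] using h
      · intro j _ hj
        have : m < j := by
          rw [Fin.lt_def, hm]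
          exact Nat.pos_of_ne_zero fun h0 => hj (Fin.ext (h0.trans hm.symm))
        rw [ih j this, Pi.zero_apply, mul_zero]
      · simp
    · set p : Fin n := ⟨m - 1, by omega⟩ with hp
      have hpm : p < m := by rw [Fin.lt_def]; simp only [hp]; omega
      have hxx := hx hpm
      set r := expFun κ (x m) (x p) with hr
      have hr1 : r < 1 := by
        rw [hr, expFun, Real.exp_lt_one_iff, neg_lt_zero]
        exact mul_pos hκ (abs_pos.2 (sub_ne_zero.2 hxx.ne))
      have hr0 : 0 < r := expFun_pos _ _ _
      have h : ∑ j, (expFun κ (x j) (x m) * c j - r * (expFun κ (x j) (x p) * c j)) = 0 := by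
        rw [Finset.sum_sub_distrib, ← Finset.mul_sum, hrow, hrow, mul_zero, sub_zero]
      rw [Finset.sum_eq_single m] at h
      · rw [expFun_self, ← hr, one_mul, ← mul_assoc] at h
        -- Only column `m` survives, and `r < 1` makes its coefficient nonzero.
        have h' : (1 - r * r) * c m = 0 := by linarith
        exact (mul_eq_zero.1 h').resolve_left (by nlinarith)
      · intro j _ hj
        rcases lt_or_gt_of_ne hj with hlt | hgt
        · have hjp : x j ≤ x p := hx.monotone (by
            rw [Fin.le_def]; rw [Fin.lt_def] at hlt; simp only [hp]; omega)
          have : expFun κ (x j) (x m) = r * expFun κ (x j) (x p) := by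
            rw [hr, expFun, expFun, expFun, ← Real.exp_add, abs_of_nonneg (by linarith),
              abs_of_neg (sub_neg.2 hxx), abs_of_nonneg (by linarith)]
            congr 1
            ring
          rw [this]
          ring
        · rw [ih j hgt]
          simp
      · simp

theorem expMatrix_mulVec_surjective {n : ℕ} {κ : ℝ} (hκ : 0 < κ) {x : Fin n → ℝ}
    (hx : StrictMono x) (v : Fin n → ℝ) : ∃ c, expMatrix κ x *ᵥ c = v := by
  have hinj : Function.Injective (expMatrix κ x).mulVecLin :=
    (injective_iff_map_eq_zero _).2 fun c hc => expMatrix_mulVec_injective hκ hx hc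
  exact LinearMap.injective_iff_surjective.1 hinj v

/-! ### Combinations of exponentials as energy minimizers. -/

theorem contRep_sum_smul {ι : Type*} (s : Finset ι) (c : ι → ℂ) (f : ι → H1) (y : ℝ) :
    contRep (∑ j ∈ s, c j • f j) y = ∑ j ∈ s, c j * contRep (f j) y := by
  classical
  induction s using Finset.induction_on with
  | empty =>
    have h := congrFun (contRep_smul 0 0) y
    rw [zero_smul, zero_smul] at h
    simpa using h
  | insert a s ha ih =>
    rw [Finset.sum_insert ha, Finset.sum_insert ha, contRep_add, Pi.add_apply, ih, contRep_smul,
      Pi.smul_apply, smul_eq_mul]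

/-- The linear combination `∑ j, c j • exp (-κ |· - x j|)` in `H¹(ℝ)`. -/
def expCombination {n : ℕ} {κ : ℝ} (hκ : 0 < κ) (x c : Fin n → ℝ) : H1 :=
  ∑ j, (c j : ℂ) • expH1 hκ (x j)

theorem contRep_expCombination {n : ℕ} {κ : ℝ} (hκ : 0 < κ) (x c : Fin n → ℝ) (i : Fin n) :
    contRep (expCombination hκ x c) (x i) = ((expMatrix κ x *ᵥ c) i : ℂ) := by
  rw [expCombination, contRep_sum_smul, expMatrix_mulVec]
  push_cast
  simp only [contRep_expH1, mul_comm]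

theorem inner_energyMap_expCombination {n : ℕ} {κ : ℝ} (hκ : 0 < κ) (x c : Fin n → ℝ) (g : H1) :
    ⟪energyMap κ (expCombination hκ x c), energyMap κ g⟫_ℂ
      = 2 * κ * ∑ j, (c j : ℂ) * contRep g (x j) := by
  rw [expCombination, map_sum, sum_inner, Finset.mul_sum]
  refine Finset.sum_congr rfl fun j _ => ?_
  rw [map_smul, inner_smul_left, Complex.conj_ofReal, inner_energyMap_expH1]
  ring

theorem norm_energyMap_expCombination_sq {n : ℕ} {κ : ℝ} (hκ : 0 < κ) (x c : Fin n → ℝ) :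
    ‖energyMap κ (expCombination hκ x c)‖ ^ 2 = 2 * κ * (c ⬝ᵥ expMatrix κ x *ᵥ c) := by
  have h := inner_energyMap_expCombination hκ x c (expCombination hκ x c)
  rw [inner_self_eq_norm_sq_to_K] at h
  simp only [contRep_expCombination, Complex.coe_algebraMap] at h
  rw [dotProduct]
  exact_mod_cast h

/-- Among the `f ∈ H¹(ℝ)` with given values at the points `x j`, the combination of exponentials
has the least energy. -/
theorem dotProduct_le_norm_energyMap_sq {n : ℕ} {κ : ℝ} (hκ : 0 < κ) (x c : Fin n → ℝ) (f : H1)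
    (hf : ∀ j, contRep f (x j) = ((expMatrix κ x *ᵥ c) j : ℂ)) :
    2 * κ * (c ⬝ᵥ expMatrix κ x *ᵥ c) ≤ ‖energyMap κ f‖ ^ 2 := by
  have h := norm_inner_le_norm (𝕜 := ℂ) (energyMap κ (expCombination hκ x c)) (energyMap κ f)
  have h2 := norm_energyMap_expCombination_sq hκ x c
  -- This inner product sees `f` only through its values at the points, so it equals the energy of
  -- the combination itself; Cauchy–Schwarz then gives the claim.
  have e : ⟪energyMap κ (expCombination hκ x c), energyMap κ f⟫_ℂ
      = ((2 * κ * (c ⬝ᵥ expMatrix κ x *ᵥ c) : ℝ) : ℂ) := by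
    rw [inner_energyMap_expCombination, dotProduct]
    simp only [hf]
    push_cast
    rfl
  rw [e, Complex.norm_real, Real.norm_eq_abs, ← h2, abs_of_nonneg (sq_nonneg _)] at h
  rw [← h2]
  rcases (norm_nonneg (energyMap κ (expCombination hκ x c))).eq_or_lt with h0 | hpos
  · rw [← h0, zero_pow two_ne_zero]
    exact sq_nonneg _
  · have : ‖energyMap κ (expCombination hκ x c)‖ ≤ ‖energyMap κ f‖ := by
      rw [sq] at h
      exact le_of_mul_le_mul_left h hpos
    gcongr

/-- Cauchy–Schwarz in the energy space for evaluation at `x i`. This controls the interaction term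
by the energy and, with injectivity, makes the matrix positive definite. -/
theorem expMatrix_mulVec_sq_le {n : ℕ} {κ : ℝ} (hκ : 0 < κ) (x c : Fin n → ℝ) (i : Fin n) :
    (expMatrix κ x *ᵥ c) i ^ 2 ≤ c ⬝ᵥ expMatrix κ x *ᵥ c := by
  have h := norm_inner_le_norm (𝕜 := ℂ) (energyMap κ (expH1 hκ (x i)))
    (energyMap κ (expCombination hκ x c))
  rw [inner_energyMap_expH1, contRep_expCombination] at h
  have h' := pow_le_pow_left₀ (norm_nonneg _) h 2
  rw [mul_pow, norm_energyMap_expH1_self_sq, norm_energyMap_expCombination_sq] at h'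
  have e : ‖(2 * κ * ((expMatrix κ x *ᵥ c) i : ℂ) : ℂ)‖ ^ 2
      = (2 * κ * (2 * κ)) * (expMatrix κ x *ᵥ c) i ^ 2 := by
    rw [← Complex.ofReal_ofNat, ← Complex.ofReal_mul, ← Complex.ofReal_mul, Complex.norm_real,
      Real.norm_eq_abs, sq_abs]
    ring
  rw [e, mul_assoc (2 * κ) (2 * κ) (_ ^ 2)] at h'
  refine le_of_mul_le_mul_left (le_of_mul_le_mul_left h' ?_) ?_ <;> positivity

/-! ### The reduced quadratic form. -/

/-- The quadratic form of `-Δ + ∑ j, α j • δ_{x j} + κ²` on combinations of the functions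
`exp (-κ |· - x j|)`. -/
def reducedForm {n : ℕ} (α x : Fin n → ℝ) (κ : ℝ) (c : Fin n → ℝ) : ℝ :=
  2 * κ * (c ⬝ᵥ expMatrix κ x *ᵥ c) + ∑ j, α j * (expMatrix κ x *ᵥ c) j ^ 2

theorem continuous_reducedForm {n : ℕ} (α x : Fin n → ℝ) :
    Continuous fun p : ℝ × (Fin n → ℝ) => reducedForm α x p.1 p.2 := by
  have h := continuous_pi_iff.1 (continuous_expMatrix_mulVec x)
  exact ((continuous_const.mul continuous_fst).mul (continuous_finsetSum _ fun j _ =>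
    ((continuous_apply j).comp continuous_snd).mul (h j))).add
    (continuous_finsetSum _ fun j _ => continuous_const.mul ((h j).pow 2))

theorem reducedForm_smul {n : ℕ} (α x : Fin n → ℝ) (κ t : ℝ) (c : Fin n → ℝ) :
    reducedForm α x κ (t • c) = t ^ 2 * reducedForm α x κ c := by
  simp only [reducedForm, mulVec_smul, dotProduct_smul, smul_dotProduct, smul_eq_mul,
    Pi.smul_apply, mul_add, Finset.mul_sum]
  congr 1
  · ring
  · exact Finset.sum_congr rfl fun j _ => by ring

theorem dotProduct_expMatrix_mulVec_pos {n : ℕ} {κ : ℝ} (hκ : 0 < κ) {x : Fin n → ℝ}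
    (hx : StrictMono x) {c : Fin n → ℝ} (hc : c ≠ 0) : 0 < c ⬝ᵥ expMatrix κ x *ᵥ c := by
  obtain ⟨i, hi⟩ : ∃ i, (expMatrix κ x *ᵥ c) i ≠ 0 := by
    by_contra! h
    exact hc (expMatrix_mulVec_injective hκ hx (funext h))
  exact (pow_pos (abs_pos.2 hi) 2).trans_le
    ((sq_abs _).le.trans (expMatrix_mulVec_sq_le hκ x c i))

/-- Every squared point value is at most `c·Mc`, so the interaction is at least `-(∑ |α j|) c·Mc`,
which the energy `2κ c·Mc` outweighs. -/
theorem reducedForm_pos {n : ℕ} {α x : Fin n → ℝ} (hx : StrictMono x) {κ : ℝ} (hκ : 0 < κ)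
    (hα : ∑ j, |α j| < 2 * κ) {c : Fin n → ℝ} (hc : c ≠ 0) : 0 < reducedForm α x κ c := by
  have hpos := dotProduct_expMatrix_mulVec_pos hκ hx hc
  have h : -((∑ j, |α j|) * (c ⬝ᵥ expMatrix κ x *ᵥ c))
      ≤ ∑ j, α j * (expMatrix κ x *ᵥ c) j ^ 2 := by
    rw [Finset.sum_mul, ← Finset.sum_neg_distrib]
    refine Finset.sum_le_sum fun j _ => ?_
    have h1 := mul_le_mul_of_nonneg_left (expMatrix_mulVec_sq_le hκ x c j) (abs_nonneg (α j))
    have h2 := mul_le_mul_of_nonneg_right (neg_abs_le (α j)) (sq_nonneg ((expMatrix κ x *ᵥ c) j))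
    linarith
  have := mul_pos (sub_pos.2 hα) hpos
  rw [reducedForm]
  linarith

/-- The quantity in `h` is the form of `-Δ + ∑ α j δ_{x j}` on `exp (-κ₀ |· - y|)`. A small shift
`κ²` keeps it negative, and interpolating the same values by exponentials of rate `κ` can only lower
it. -/
theorem exists_reducedForm_neg {n : ℕ} {α x : Fin n → ℝ} (hx : StrictMono x) {κ₀ : ℝ}
    (hκ₀ : 0 < κ₀) (y : ℝ) (h : κ₀ + ∑ j, α j * expFun κ₀ y (x j) ^ 2 < 0) :
    ∃ κ, 0 < κ ∧ ∃ c, reducedForm α x κ c < 0 := by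
  set S := ∑ j, α j * expFun κ₀ y (x j) ^ 2 with hS
  have hpos : 0 < -(κ₀ + S) * κ₀ / 2 := by
    have := mul_pos (neg_pos.2 h) hκ₀
    linarith
  -- The shift adds `κ² ‖f‖² = κ² / κ₀` to the form; this `κ` makes that half of `-(κ₀ + S)`,
  -- leaving `(κ₀ + S) / 2 < 0`.
  refine ⟨√(-(κ₀ + S) * κ₀ / 2), Real.sqrt_pos.2 hpos, ?_⟩
  set κ := √(-(κ₀ + S) * κ₀ / 2) with hκdef
  have hκ : 0 < κ := Real.sqrt_pos.2 hpos
  obtain ⟨c, hc⟩ := expMatrix_mulVec_surjective hκ hx fun j => expFun κ₀ y (x j)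
  refine ⟨c, ?_⟩
  have h1 := dotProduct_le_norm_energyMap_sq hκ x c (expH1 hκ₀ y) fun j => by
    rw [contRep_expH1, hc]
  rw [norm_energyMap_expH1_sq, hκdef, Real.sq_sqrt hpos.le, ← hκdef] at h1
  have h2 : -(κ₀ + S) * κ₀ / 2 / κ₀ = -(κ₀ + S) / 2 := by field_simp
  rw [h2] at h1
  have h3 : reducedForm α x κ c = 2 * κ * (c ⬝ᵥ expMatrix κ x *ᵥ c) + S := by
    rw [reducedForm, hc]
  rw [h3]
  linarith

/-- A zero of a nonnegative quadratic form is a minimizer. The derivative in direction `d` is `2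
r·Md`, where `r` is the residual of the claimed equation, and surjectivity of `M` allows `M d = r`.
-/
theorem stationary_of_reducedForm_eq_zero {n : ℕ} {α x : Fin n → ℝ} (hx : StrictMono x) {κ : ℝ}
    (hκ : 0 < κ) {c : Fin n → ℝ} (hc : reducedForm α x κ c = 0)
    (hn : ∀ d, 0 ≤ reducedForm α x κ d) (j : Fin n) :
    2 * κ * c j + α j * (expMatrix κ x *ᵥ c) j = 0 := by
  set r : Fin n → ℝ := fun j => 2 * κ * c j + α j * (expMatrix κ x *ᵥ c) j with hr
  obtain ⟨d, hd⟩ := expMatrix_mulVec_surjective hκ hx r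
  have hexp : ∀ t : ℝ, reducedForm α x κ (c + t • d)
      = reducedForm α x κ d * (t * t) + 2 * (r ⬝ᵥ r) * t + reducedForm α x κ c := by
    intro t
    have e : r ⬝ᵥ r = 2 * κ * (c ⬝ᵥ expMatrix κ x *ᵥ d)
        + ∑ j, α j * ((expMatrix κ x *ᵥ c) j * (expMatrix κ x *ᵥ d) j) := by
      rw [hd, dotProduct, dotProduct, Finset.mul_sum, ← Finset.sum_add_distrib]
      refine Finset.sum_congr rfl fun j _ => ?_
      simp only [hr]
      ring
    have e2 : ∑ j, α j * (expMatrix κ x *ᵥ (c + t • d)) j ^ 2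
        = ∑ j, α j * (expMatrix κ x *ᵥ c) j ^ 2
          + 2 * t * ∑ j, α j * ((expMatrix κ x *ᵥ c) j * (expMatrix κ x *ᵥ d) j)
          + t ^ 2 * ∑ j, α j * (expMatrix κ x *ᵥ d) j ^ 2 := by
      rw [Finset.mul_sum, Finset.mul_sum, ← Finset.sum_add_distrib, ← Finset.sum_add_distrib]
      refine Finset.sum_congr rfl fun j _ => ?_
      simp only [mulVec_add, mulVec_smul, Pi.add_apply, Pi.smul_apply, smul_eq_mul]
      ring
    rw [e]
    simp only [reducedForm]
    rw [e2]
    simp only [mulVec_add, mulVec_smul, dotProduct_add, add_dotProduct,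
      dotProduct_smul, smul_dotProduct, smul_eq_mul]
    rw [dotProduct_expMatrix_mulVec_comm κ x c d]
    ring
  -- A quadratic in `t` that is nonnegative with zero constant term has no linear term, so `r ⬝ᵥ r =
  -- 0`.
  have hdisc := discrim_le_zero (a := reducedForm α x κ d) (b := 2 * (r ⬝ᵥ r)) (c := 0)
    fun t => by simpa [hexp t, hc] using hn (c + t • d)
  rw [discrim, mul_zero, sub_zero] at hdisc
  have hr0 : r ⬝ᵥ r = 0 := by
    have := pow_eq_zero_iff (two_ne_zero) |>.1 (le_antisymm hdisc (sq_nonneg _))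
    linarith
  exact congrFun (dotProduct_self_eq_zero.1 hr0) j

/-! ### From stationary vectors to eigenfunctions. -/

theorem form_pointMeasure {n : ℕ} (α x : Fin n → ℝ) (f g : H1) :
    form (pointMeasure α x) f g = ⟪weakDeriv g, weakDeriv f⟫_ℂ
      + ∑ j, (α j : ℂ) * (contRep f (x j) * conj (contRep g (x j))) := by
  rw [form, integral_mul_conj, pointMeasure, VectorMeasure.integral_finsetSum_vectorMeasure
    fun j _ => integrable_contRep_mul _ f g]
  congr 1
  refine Finset.sum_congr rfl fun j _ => ?_
  rw [VectorMeasure.integral_dirac]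
  simp

/-- The equations `hc` are the jump conditions at the points: the boundary terms `2κ c j` from the
reproducing property cancel the point interactions, leaving only `-κ² ⟨f, g⟩`. -/
theorem form_expCombination {n : ℕ} {α x : Fin n → ℝ} {κ : ℝ} (hκ : 0 < κ) {c : Fin n → ℝ}
    (hc : ∀ j, 2 * κ * c j + α j * (expMatrix κ x *ᵥ c) j = 0) (g : H1) :
    form (pointMeasure α x) (expCombination hκ x c) g
      = -(κ : ℂ) ^ 2 * ⟪(g : L2), (expCombination hκ x c : L2)⟫_ℂ := by
  have h := congrArg conj (inner_energyMap_expCombination hκ x c g)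
  rw [inner_energyMap] at h
  simp only [map_add, map_mul, map_sum, map_pow, map_ofNat, Complex.conj_ofReal,
    inner_conj_symm] at h
  have h0 : 2 * (κ : ℂ) * (∑ j, (c j : ℂ) * conj (contRep g (x j)))
      + ∑ j, (α j : ℂ) * (((expMatrix κ x *ᵥ c) j : ℂ) * conj (contRep g (x j))) = 0 := by
    rw [Finset.mul_sum, ← Finset.sum_add_distrib]
    refine Finset.sum_eq_zero fun j _ => ?_
    have := congrArg (Complex.ofReal) (hc j)
    push_cast at this
    linear_combination conj (contRep g (x j)) * this
  rw [form_pointMeasure]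
  simp only [contRep_expCombination]
  linear_combination h + h0

theorem isEigenvalue_schrodinger_pointMeasure {n : ℕ} {α x : Fin n → ℝ} (hx : StrictMono x)
    {κ : ℝ} (hκ : 0 < κ) {c : Fin n → ℝ} (hc0 : c ≠ 0)
    (hc : ∀ j, 2 * κ * c j + α j * (expMatrix κ x *ᵥ c) j = 0) :
    IsEigenvalue (schrodinger (pointMeasure α x)) ((-κ ^ 2 : ℝ) : ℂ) := by
  set f := expCombination hκ x c with hf
  have hmem : ((f : L2), ((-κ ^ 2 : ℝ) : ℂ) • (f : L2))
      ∈ (schrodinger (pointMeasure α x)).graph := by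
    rw [schrodinger_graph]
    refine ⟨f, rfl, fun g => ?_⟩
    rw [form_expCombination hκ hc, inner_smul_right]
    push_cast
    rfl
  obtain ⟨u, hu, hAu⟩ := (LinearPMap.mem_graph_iff _).1 hmem
  refine ⟨u, ?_, by rw [hAu, hu]⟩
  rw [hu]
  -- A zero function has zero energy, but the energy here is `2κ c·Mc > 0`.
  intro h0
  have hf0 : f = 0 := Subtype.ext h0
  have h := norm_energyMap_expCombination_sq hκ x c
  rw [← hf, hf0, map_zero, norm_zero, zero_pow two_ne_zero] at h
  have := mul_pos (mul_pos two_pos hκ) (dotProduct_expMatrix_mulVec_pos hκ hx hc0)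
  linarith

theorem exists_neg_eigenvalue_of_expFun {n : ℕ} {α x : Fin n → ℝ} (hx : StrictMono x) {κ₀ : ℝ}
    (hκ₀ : 0 < κ₀) (y : ℝ) (h : κ₀ + ∑ j, α j * expFun κ₀ y (x j) ^ 2 < 0) :
    ∃ E : ℝ, E < 0 ∧ IsEigenvalue (schrodinger (pointMeasure α x)) (E : ℂ) := by
  obtain ⟨a, ha, hneg⟩ := exists_reducedForm_neg hx hκ₀ y h
  have hsum : 0 ≤ ∑ j, |α j| := Finset.sum_nonneg fun j _ => abs_nonneg _
  -- The right endpoint lies beyond `a` and satisfies `∑ |α j| < 2b`, which ensures positive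
  -- definiteness there.
  obtain ⟨κ, hκ, c, hc0, hqc, hqn⟩ := exists_nonneg_eq_zero_of_quadratic
    (b := a + ∑ j, |α j|) (continuous_reducedForm α x) (reducedForm_smul α x)
    (by linarith) hneg fun c hc => reducedForm_pos hx (by linarith) (by linarith) hc
  have hκ0 : 0 < κ := ha.trans_le hκ
  exact ⟨-κ ^ 2, neg_lt_zero.2 (pow_pos hκ0 2), isEigenvalue_schrodinger_pointMeasure hx hκ0 hc0
    (stationary_of_reducedForm_eq_zero hx hκ0 hqc hqn)⟩

end PointInteraction

end

/-! ### The explicit criterion. -/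

theorem mainTheorem11 (n : ℕ) (α x : Fin n → ℝ) (hx : StrictMono x) (k : Fin n) (hk : α k < 0)
    (h : α k / 2 * Real.exp (-(α k) * x k)
        + ∑ j with x j < x k, α j * Real.exp (-(α k) * x j)
        + Real.exp (-2 * α k * x k) * ∑ j with x k < x j, α j * Real.exp (α k * x j) < 0) :
    ∃ E : ℝ, E < 0 ∧
      PointInteraction.IsEigenvalue
        (PointInteraction.schrodinger (PointInteraction.pointMeasure α x)) (E : ℂ) := by
  refine PointInteraction.exists_neg_eigenvalue_of_expFun hx (κ₀ := -(α k) / 2) (by linarith)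
    (x k) ?_
  have hsplit : ∑ j, α j * PointInteraction.expFun (-(α k) / 2) (x k) (x j) ^ 2
      = α k + Real.exp (α k * x k) * (∑ j with x j < x k, α j * Real.exp (-(α k) * x j)
        + Real.exp (-2 * α k * x k) * ∑ j with x k < x j, α j * Real.exp (α k * x j)) := by
    -- Writing `α k` as a sum supported at `k` lets the identity be checked term by term, according
    -- to the position of `x j` relative to `x k`.
    have e : ∀ s, α k + s = (∑ j, if j = k then α j else 0) + s := by simp
    rw [Finset.sum_filter, Finset.sum_filter, Finset.mul_sum, ← Finset.sum_add_distrib,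
      Finset.mul_sum, e, ← Finset.sum_add_distrib]
    refine Finset.sum_congr rfl fun j _ => ?_
    rw [PointInteraction.expFun_sq, PointInteraction.expFun]
    rcases lt_trichotomy (x j) (x k) with hlt | heq | hgt
    · have hne : j ≠ k := fun hjk => hlt.ne (congrArg x hjk)
      rw [if_neg hne, if_pos hlt, if_neg hlt.not_gt, abs_of_neg (sub_neg.2 hlt), mul_zero,
        add_zero, zero_add, mul_left_comm, ← Real.exp_add]
      congr 2
      ring
    · have hjk : j = k := hx.injective heq
      subst hjk
      simp
    · have hne : j ≠ k := fun hjk => hgt.ne' (congrArg x hjk)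
      rw [if_neg hne, if_pos hgt, if_neg hgt.not_gt, abs_of_pos (sub_pos.2 hgt), zero_add,
        zero_add, mul_left_comm (Real.exp (-2 * α k * x k)), mul_left_comm, ← Real.exp_add,
        ← Real.exp_add]
      congr 2
      ring
  -- Since `κ₀ + α k = α k / 2`, the trial value is the left side of `h` times `exp (α k * x k)`.
  have h1 := mul_neg_of_pos_of_neg (Real.exp_pos (α k * x k)) h
  have h2 : Real.exp (α k * x k) * Real.exp (-(α k) * x k) = 1 := by
    rw [← Real.exp_add, ← Real.exp_zero]
    congr 1
    ring
  rw [hsplit]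
  linear_combination h1 - α k / 2 * h2
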